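/- **Formulas and models.** Modal formulas over a countable set of atoms are built from literals $p,\overline p$ and $\top,\bot$ by $\wedge,\vee,\Box,\Diamond$, with the usual Kripke semantics. Let $\mathsf L\in\{\mathsf{K5},\mathsf{KD5},\mathsf{K45},\mathsf{KD45},\mathsf{KB5},\mathsf{S5}\}$. An $\mathsf L$-model is a Kripke model $(W,R,V)$ with a root $\rho\in W$ such that $R$ is Euclidean and $(W,R)$ has one of the following forms, where $C$ is a finite cluster (nonempty, $C\times C\subseteq R$), and in the forms $\{\rho\}$ and $\{\rho\}\sqcup C$ not $\rho R\rho$, and in the latter form $\rho R w$ for some $w\in C$: $\mathsf{K5}$: $W=\{\rho\}$ or $W=\{\rho\}\sqcup C$; $\mathsf{KD5}$: $W=\{\rho\}\sqcup C$; $\mathsf{K45}$: $W=\{\rho\}$, or $W=\{\rho\}\sqcup C$ with $\rho R w$ for all $w\in C$; $\mathsf{KD45}$: $W=\{\rho\}\sqcup C$ with $\rho R w$ for all $w\in C$; $\mathsf{KB5}$: $W=\{\rho\}$ or $W=C$; $\mathsf{S5}$: $W=C$ (when $W=C$, any world may be the root). Write $\vDash_{\mathsf L}\phi$ if $\phi$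 is true at the root of every $\mathsf L$-model. **Sequents.** A layered sequent is $\mathcal G=\Gamma_1,\dots,\Gamma_n,[\Sigma_1],\dots,[\Sigma_m],[[\Pi_1]],\dots,[[\Pi_k]]$ with finite multisets $\Gamma_i,\Sigma_i,\Pi_i$ of formulas, where $k\ge1$ implies $m\ge1$; the order of components is irrelevant, and the $\Gamma_i$ are identified with their union, the trunk, which exists iff $n\ge1$. It is an $\mathsf L$-sequent if: $n\ge1$ (for $\mathsf{K5},\mathsf{KD5}$); $n\ge1,k=0$ (for $\mathsf{K45},\mathsf{KD45}$); $n=0,m\ge2,k=0$ or $n=1,m=k=0$ (for $\mathsf{KB5}$); $n=0,m\ge1,k=0$ (for $\mathsf{S5}$). Its formula interpretation is $$\iota(\mathcal G)=\bigvee_i\bigl(\bigvee\Gamma_i\bigr)\vee\bigvee_i\Box\bigl(\bigvee\Sigma_i\bigr)\vee\bigvee_i\Box\Box\bigl(\bigvee\Pi_i\bigr).$$ **Calculi.** Let $\mathcal G\{\ \}$ be a sequent with a hole in one component, and let $\langle\ \rangle,\langle\ \rangle'$ each stand for $[\ ]$ or $[[\ ]]$. The rules, written premises $/$ conclusion, are: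 - $\mathsf{id_P}$: $\ /\ \mathcal G\{p,\overline p\}$; $\quad\mathsf{id_\top}$: $\ /\ \mathcal G\{\top\}$; - $\wedge$: $\mathcal G\{\phi\wedge\psi,\phi\}$ and $\mathcal G\{\phi\wedge\psi,\psi\}\ /\ \mathcal G\{\phi\wedge\psi\}$; $\quad\vee$: $\mathcal G\{\phi\vee\psi,\phi,\psi\}\ /\ \mathcal G\{\phi\vee\psi\}$; - $\Box_t$: $\mathcal G,\Box\phi,[\phi]\ /\ \mathcal G,\Box\phi$; $\quad\Box_{t'}$: $[\Sigma,\Box\phi],[\phi]\ /\ \Sigma,\Box\phi$; $\quad\Diamond_t$: $\mathcal G,\Diamond\phi,[\Sigma,\phi]\ /\ \mathcal G,\Diamond\phi,[\Sigma]$; - $\Box_c$: $\mathcal G,\langle\Sigma,\Box\phi\rangle,[\phi]\ /\ \mathcal G,\langle\Sigma,\Box\phi\rangle$; $\quad\Box_{c'}$: the same with $[[\phi]]$ in place of $[\phi]$; - $\Diamond_c$: $\mathcal G,\langle\Sigma,\Diamond\phi\rangle,\langle\Pi,\phi\rangle'\ /\ \mathcal G,\langle\Sigma,\Diamond\phi\rangle,\langle\Pi\rangle'$;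 $\quad\mathsf t$: $\mathcal G,\langle\Sigma,\Diamond\phi,\phi\rangle\ /\ \mathcal G,\langle\Sigma,\Diamond\phi\rangle$; - $\mathsf d_t$: $\mathcal G,\Diamond\phi,[\phi]\ /\ \mathcal G,\Diamond\phi$; $\quad\mathsf d_c$: $\mathcal G,\langle\Sigma,\Diamond\phi\rangle,[\phi]\ /\ \mathcal G,\langle\Sigma,\Diamond\phi\rangle$; $\quad\mathsf d_{c'}$: the same with $[[\phi]]$ in place of $[\phi]$. Every calculus $\mathsf{L.L}$ has $\mathsf{id_P},\mathsf{id_\top},\wedge,\vee,\Diamond_c,\mathsf t$; in addition $\mathsf{L.K5}$ has $\Box_t,\Diamond_t,\Box_{c'}$; $\mathsf{L.KD5}$ has $\Box_t,\Diamond_t,\Box_{c'},\mathsf d_t,\mathsf d_{c'}$; $\mathsf{L.K45}$ has $\Box_t,\Diamond_t,\Box_c$; $\mathsf{L.KD45}$ has $\Box_t,\Diamond_t,\Box_c,\mathsf d_t,\mathsf d_c$; $\mathsf{L.KB5}$ has $\Box_{t'},\Box_c$; $\mathsf{L.S5}$ has $\Box_c$. Rules of $\mathsf{L.L}$ are applied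 to $\mathsf L$-sequents only. Write $\vdash_{\mathsf{L.L}}\mathcal G$ if $\mathcal G$ is derivable in $\mathsf{L.L}$. **Interpretations.** Label the trunk of $\mathcal G$ (if any) by $\bullet$, its $[\ ]$-components by distinct labels $\bullet i$, and its $[[\ ]]$-components by distinct labels $j$. An interpretation of $\mathcal G$ into an $\mathsf L$-model $\mathcal M$ with root $\rho$ is a map $\mathcal I$ from the labels of $\mathcal G$ to $W$ such that, for all labels of the respective types that occur in $\mathcal G$: $\mathcal I(\bullet)=\rho$; $\mathcal I(\bullet)R\,\mathcal I(\bullet i)$; $\mathcal I(\bullet i)R\,\mathcal I(j)$ and $\mathcal I(j)R\,\mathcal I(\bullet i)$; not $\mathcal I(\bullet)R\,\mathcal I(j)$; and $\mathcal I(\bullet i)R\,\mathcal I(\bullet i')$ for all $\bullet i,\bullet i'$ (the last condition is automatic except for $\mathsf{KB5}$-sequents without trunk). Write $\vDash_{\mathsf L}\mathcal G$ if, for every $\mathsf L$-model $\mathcal M$ and every interpretation $\mathcal I$ of $\mathcal G$ into $\mathcal M$, some formula $\phi$ in some component of $\mathcal G$ with label $\sigma$ satisfies $\mathcal M,\mathcal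 I(\sigma)\vDash\phi$. **Theorem (Soundness and completeness).** For every $\mathsf L\in\{\mathsf{K5},\mathsf{KD5},\mathsf{K45},\mathsf{KD45},\mathsf{KB5},\mathsf{S5}\}$ and every $\mathsf L$-sequent $\mathcal G$, $$\vdash_{\mathsf{L.L}}\mathcal G\quad\Longleftrightarrow\quad\vDash_{\mathsf L}\iota(\mathcal G)\quad\Longleftrightarrow\quad\vDash_{\mathsf L}\mathcal G.$$ -/

import Mathlib

namespace Layered

universe u

/-- Modal formulas over the atoms `Pr`, in negation normal form. -/
inductive Formula (Pr : Type u) : Type u where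
  | top : Formula Pr
  | bot : Formula Pr
  | atom (p : Pr) : Formula Pr
  | natom (p : Pr) : Formula Pr
  | and (φ ψ : Formula Pr) : Formula Pr
  | or (φ ψ : Formula Pr) : Formula Pr
  | box (φ : Formula Pr) : Formula Pr
  | dia (φ : Formula Pr) : Formula Pr

/-- A Kripke model on the set of worlds `W`. -/
structure KripkeModel (Pr : Type u) (W : Type) where
  R : W → W → Prop
  V : Pr → Set W

/-- Truth of a formula at a world. -/
def KripkeModel.Sat {Pr : Type u} {W : Type} (M : KripkeModel Pr W) : W → Formula Pr → Prop
  | _, .top => True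
  | _, .bot => False
  | w, .atom p => w ∈ M.V p
  | w, .natom p => w ∉ M.V p
  | w, .and φ ψ => M.Sat w φ ∧ M.Sat w ψ
  | w, .or φ ψ => M.Sat w φ ∨ M.Sat w ψ
  | w, .box φ => ∀ v, M.R w v → M.Sat v φ
  | w, .dia φ => ∃ v, M.R w v ∧ M.Sat v φ

/-- The six logics. -/
inductive Logic where
  | K5 | KD5 | K45 | KD45 | KB5 | S5

section Frames

variable {W : Type}

/-- `R` is Euclidean. -/
def Euclidean (R : W → W → Prop) : Prop :=
  ∀ w v u, R w v → R w u → R v u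

/-- `C` is a finite cluster: nonempty, finite, and `R` is total on it. -/
def IsFiniteCluster (R : W → W → Prop) (C : Set W) : Prop :=
  C.Nonempty ∧ C.Finite ∧ ∀ w ∈ C, ∀ v ∈ C, R w v

/-- `W = {ρ}` with `ρ` irreflexive. -/
def SingleFrame (R : W → W → Prop) (ρ : W) : Prop :=
  (∀ w, w = ρ) ∧ ¬ R ρ ρ

/-- `W = {ρ} ⊔ C` for a finite cluster `C`, where the root `ρ` is irreflexive and sees some world
of `C`. -/
def RootClusterFrame (R : W → W → Prop) (ρ : W) : Prop :=
  ¬ R ρ ρ ∧ ∃ C : Set W,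
    IsFiniteCluster R C ∧ ρ ∉ C ∧ (∀ w, w = ρ ∨ w ∈ C) ∧ ∃ w ∈ C, R ρ w

/-- `W = {ρ} ⊔ C` for a finite cluster `C`, where the root `ρ` is irreflexive and sees all worlds
of `C`. -/
def RootAllClusterFrame (R : W → W → Prop) (ρ : W) : Prop :=
  ¬ R ρ ρ ∧ ∃ C : Set W,
    IsFiniteCluster R C ∧ ρ ∉ C ∧ (∀ w, w = ρ ∨ w ∈ C) ∧ ∀ w ∈ C, R ρ w

/-- `W = C` is a finite cluster. Every world can then serve as the root. -/
def ClusterFrame (R : W → W → Prop) : Prop :=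
  IsFiniteCluster R (Set.univ : Set W)

/-- The shape required of a frame with root `ρ`, for each logic. -/
def FrameShape (R : W → W → Prop) (ρ : W) : Logic → Prop
  | .K5 => SingleFrame R ρ ∨ RootClusterFrame R ρ
  | .KD5 => RootClusterFrame R ρ
  | .K45 => SingleFrame R ρ ∨ RootAllClusterFrame R ρ
  | .KD45 => RootAllClusterFrame R ρ
  | .KB5 => SingleFrame R ρ ∨ ClusterFrame R
  | .S5 => ClusterFrame R

/-- `(W, R)` with root `ρ` is an `L`-frame. -/
def IsFrame (L : Logic) (R : W → W → Prop) (ρ : W) : Prop :=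
  Euclidean R ∧ FrameShape R ρ L

end Frames

/-- `⊨_L φ`: truth at the root of every rooted `L`-model. Since `L`-models are finite, it is enough
to let `W` range over `Type`. -/
def ValidFormula {Pr : Type u} (L : Logic) (φ : Formula Pr) : Prop :=
  ∀ (W : Type) (M : KripkeModel Pr W) (ρ : W), IsFrame L M.R ρ → M.Sat ρ φ

/-- A sequent `Γ, [S₁], …, [Sₘ], [[P₁]], …, [[Pₖ]]`. `trunk` is `none` when there is no trunk
(`n = 0`), and `some Γ` with `Γ` the union of all `Γᵢ` when `n ≥ 1`. The restriction that `k ≥ 1`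
implies `m ≥ 1` is imposed in `IsLayered`. -/
@[ext]
structure Sequent (Pr : Type u) : Type u where
  trunk : Option (Multiset (Formula Pr))
  single : Multiset (Multiset (Formula Pr))
  double : Multiset (Multiset (Formula Pr))

/-- The two kinds of brackets: `[ ]` and `[[ ]]`. -/
inductive Bracket where
  | single | double

namespace Sequent

variable {Pr : Type u}

/-- If there is a `[[ ]]`-component then there is a `[ ]`-component. -/
def IsLayered (G : Sequent Pr) : Prop :=
  1 ≤ G.double.card → 1 ≤ G.single.card

/-- The conditions on `n`, `m`, `k` for each logic. -/
def Shape (G : Sequent Pr) : Logic → Prop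
  | .K5 | .KD5 => G.trunk.isSome
  | .K45 | .KD45 => G.trunk.isSome ∧ G.double = 0
  | .KB5 => (G.trunk = none ∧ 2 ≤ G.single.card ∧ G.double = 0) ∨
      (G.trunk.isSome ∧ G.single = 0 ∧ G.double = 0)
  | .S5 => G.trunk = none ∧ 1 ≤ G.single.card ∧ G.double = 0

/-- `G` is an `L`-sequent. -/
def IsLSequent (L : Logic) (G : Sequent Pr) : Prop :=
  G.IsLayered ∧ G.Shape L

/-- `G, D`: add the formulas of `D` to the trunk (creating it if absent). -/
def addTrunk (G : Sequent Pr) (D : Multiset (Formula Pr)) : Sequent Pr :=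
  { G with trunk := some (G.trunk.getD 0 + D) }

/-- `G, [S]` or `G, [[S]]`. -/
def addComp (G : Sequent Pr) : Bracket → Multiset (Formula Pr) → Sequent Pr
  | .single, S => { G with single := S ::ₘ G.single }
  | .double, S => { G with double := S ::ₘ G.double }

end Sequent

/-- Unary contexts `G{ }`: the hole is in the trunk, as in `G, { }`, or in a crown component, as in
`G, [S, { }]` or `G, [[S, { }]]`. -/
inductive Context (Pr : Type u) : Type u where
  | trunk (G : Sequent Pr) : Context Pr
  | crown (G : Sequent Pr) (b : Bracket) (S : Multiset (Formula Pr)) : Context Pr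

/-- `G{D}`. -/
def Context.fill {Pr : Type u} : Context Pr → Multiset (Formula Pr) → Sequent Pr
  | .trunk G, D => G.addTrunk D
  | .crown G b S, D => G.addComp b (S + D)

/-- Names of the rules; `boxTPrime`, `boxCPrime`, `dCPrime` are the primed variants. -/
inductive RuleName where
  | idP | idTop | and | or | boxT | boxTPrime | diaT | boxC | boxCPrime | diaC
  | dT | dC | dCPrime | t

open Sequent in
/-- `Rule r ps c`: from the list of premises `ps` infer `c` by an instance of the rule `r`. -/
inductive Rule {Pr : Type u} : RuleName → List (Sequent Pr) → Sequent Pr → Prop where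
  | idP (K : Context Pr) (p : Pr) :
      Rule .idP [] (K.fill {.atom p, .natom p})
  | idTop (K : Context Pr) :
      Rule .idTop [] (K.fill {.top})
  | and (K : Context Pr) (φ ψ : Formula Pr) :
      Rule .and [K.fill {.and φ ψ, φ}, K.fill {.and φ ψ, ψ}] (K.fill {.and φ ψ})
  | or (K : Context Pr) (φ ψ : Formula Pr) :
      Rule .or [K.fill {.or φ ψ, φ, ψ}] (K.fill {.or φ ψ})
  | boxT (G : Sequent Pr) (φ : Formula Pr) :
      Rule .boxT [(G.addTrunk {.box φ}).addComp .single {φ}] (G.addTrunk {.box φ})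
  | boxTPrime (S : Multiset (Formula Pr)) (φ : Formula Pr) :
      Rule .boxTPrime [⟨none, {S + {.box φ}, {φ}}, 0⟩] ⟨some (S + {.box φ}), 0, 0⟩
  | diaT (G : Sequent Pr) (S : Multiset (Formula Pr)) (φ : Formula Pr) :
      Rule .diaT [(G.addTrunk {.dia φ}).addComp .single (S + {φ})]
        ((G.addTrunk {.dia φ}).addComp .single S)
  | boxC (G : Sequent Pr) (b : Bracket) (S : Multiset (Formula Pr)) (φ : Formula Pr) :
      Rule .boxC [(G.addComp b (S + {.box φ})).addComp .single {φ}] (G.addComp b (S + {.box φ}))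
  | boxCPrime (G : Sequent Pr) (b : Bracket) (S : Multiset (Formula Pr)) (φ : Formula Pr) :
      Rule .boxCPrime [(G.addComp b (S + {.box φ})).addComp .double {φ}]
        (G.addComp b (S + {.box φ}))
  | diaC (G : Sequent Pr) (b c : Bracket) (S P : Multiset (Formula Pr)) (φ : Formula Pr) :
      Rule .diaC [(G.addComp b (S + {.dia φ})).addComp c (P + {φ})]
        ((G.addComp b (S + {.dia φ})).addComp c P)
  | dT (G : Sequent Pr) (φ : Formula Pr) :
      Rule .dT [(G.addTrunk {.dia φ}).addComp .single {φ}] (G.addTrunk {.dia φ})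
  | dC (G : Sequent Pr) (b : Bracket) (S : Multiset (Formula Pr)) (φ : Formula Pr) :
      Rule .dC [(G.addComp b (S + {.dia φ})).addComp .single {φ}] (G.addComp b (S + {.dia φ}))
  | dCPrime (G : Sequent Pr) (b : Bracket) (S : Multiset (Formula Pr)) (φ : Formula Pr) :
      Rule .dCPrime [(G.addComp b (S + {.dia φ})).addComp .double {φ}]
        (G.addComp b (S + {.dia φ}))
  | t (G : Sequent Pr) (b : Bracket) (S : Multiset (Formula Pr)) (φ : Formula Pr) :
      Rule .t [G.addComp b (S + {.dia φ, φ})] (G.addComp b (S + {.dia φ}))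

/-- The rules common to all calculi. -/
def commonRules : Set RuleName := {.idP, .idTop, .or, .and, .diaC, .t}

/-- The rules of the calculus `L.L`. -/
def rules : Logic → Set RuleName
  | .K5 => commonRules ∪ {.boxT, .diaT, .boxCPrime}
  | .KD5 => commonRules ∪ {.boxT, .diaT, .boxCPrime, .dT, .dCPrime}
  | .K45 => commonRules ∪ {.boxT, .diaT, .boxC}
  | .KD45 => commonRules ∪ {.boxT, .diaT, .boxC, .dT, .dC}
  | .KB5 => commonRules ∪ {.boxTPrime, .boxC}
  | .S5 => commonRules ∪ {.boxC}

/-- Derivability in `L.L`; rules are applied to `L`-sequents only. -/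
inductive Derivable {Pr : Type u} (L : Logic) : Sequent Pr → Prop where
  | step {r : RuleName} {ps : List (Sequent Pr)} {c : Sequent Pr}
      (hr : r ∈ rules L) (hrule : Rule r ps c)
      (hps : ∀ p ∈ ps, p.IsLSequent L) (hc : c.IsLSequent L)
      (ih : ∀ p ∈ ps, Derivable L p) : Derivable L c

section Interpretation

variable {Pr : Type u}

/-- Disjunction of a finite list of formulas; the empty disjunction is `⊥`. -/
def disjList (l : List (Formula Pr)) : Formula Pr :=
  l.foldr Formula.or Formula.bot

/-- Disjunction of a finite multiset of formulas, in some fixed order. -/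
noncomputable def disj (S : Multiset (Formula Pr)) : Formula Pr :=
  disjList S.toList

/-- The formula interpretation `ι(G)`. -/
noncomputable def Sequent.iota (G : Sequent Pr) : Formula Pr :=
  .or (disj (G.trunk.getD 0))
    (.or (disj (G.single.map fun S => .box (disj S)))
      (disj (G.double.map fun P => .box (.box (disj P)))))

/-- The labels of `G`: `trunk` is `•` (present only if there is a trunk), `single i` is `•i`, and
`double j` is `j`. Repeated components get distinct labels. -/
inductive Lab (G : Sequent Pr) : Type where
  | trunk (h : G.trunk.isSome) : Lab G
  | single (i : Fin G.single.toList.length) : Lab G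
  | double (j : Fin G.double.toList.length) : Lab G

/-- The sequent component with a given label. -/
noncomputable def Sequent.component (G : Sequent Pr) : Lab G → Multiset (Formula Pr)
  | .trunk h => G.trunk.get h
  | .single i => G.single.toList.get i
  | .double j => G.double.toList.get j

/-- `I` is an interpretation of `G` into the model `M` with root `ρ`. The last condition says that
the `[ ]`-components are sent into one cluster; it follows from the others whenever `G` has a
trunk and `M` is Euclidean. -/
structure IsInterpretation {W : Type} (G : Sequent Pr) (M : KripkeModel Pr W) (ρ : W)
    (I : Lab G → W) : Prop where
  trunk_root : ∀ h, I (.trunk h) = ρ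
  trunk_single : ∀ h i, M.R (I (.trunk h)) (I (.single i))
  single_double : ∀ i j, M.R (I (.single i)) (I (.double j)) ∧ M.R (I (.double j)) (I (.single i))
  trunk_double : ∀ h j, ¬ M.R (I (.trunk h)) (I (.double j))
  single_single : ∀ i i₁, M.R (I (.single i)) (I (.single i₁))

/-- `M, I ⊨ G`. -/
def SatSequent {W : Type} (G : Sequent Pr) (M : KripkeModel Pr W) (I : Lab G → W) : Prop :=
  ∃ σ : Lab G, ∃ φ ∈ G.component σ, M.Sat (I σ) φ

/-- `⊨_L G`: truth under all interpretations into `L`-models. -/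
def ValidSequent (L : Logic) (G : Sequent Pr) : Prop :=
  ∀ (W : Type) (M : KripkeModel Pr W) (ρ : W), IsFrame L M.R ρ →
    ∀ I : Lab G → W, IsInterpretation G M ρ I → SatSequent G M I

end Interpretation

end Layered

namespace Layered

universe v

/-! The implications run in a cycle: a derivable sequent has a valid interpretation `iota`, that
validity passes to the sequent, and a valid sequent is derivable. All three are phrased through
`Refutes`, whose parameter `D` says where `[[ ]]`-components may be falsified. With `D` = two steps
from the root, refutation is exactly failure of `iota`; with `D` = two steps away but unseen by the
root, it yields a falsifying interpretation. The second notion is the stronger one, and completeness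
closes the gap.

The frame fact behind the rules: in a Euclidean frame the worlds two steps from the root form a
cluster that contains all successors of the root. Hence a diamond in one crown component constrains
every crown component, and the witness of a box may be put in a component of its own.

Soundness is read backwards: a refutation of a conclusion refutes some premise
(`Rule.exists_refutes_premise`). For completeness, all formulas lie in a finite subformula-closed
set `F`, and backward search that only adds missing formulas decreases `searchMeasure`. A
counterexample of minimal measure (`Stuck`) must be saturated: any missing formula gives a rule
instance whose premises are smaller and have no countermodel, as one would carry over to the
conclusion, so they are derivable. A saturated sequent is its own countermodel, with the labels as
worlds (`Saturated.labModel_falsifies`). The one exception, a serial logic with empty crown, is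
repaired by adding an empty `[ ]`-component. -/

/-- `w` is reachable from `ρ` in exactly two steps. -/
def Far {W : Type} (R : W → W → Prop) (ρ w : W) : Prop := ∃ u, R ρ u ∧ R u w

/-! ### The cluster behind the root of a Euclidean frame. -/

namespace Euclidean

variable {W : Type} {R : W → W → Prop} {ρ w x : W}

theorem far_of_rel (hE : Euclidean R) (h : R ρ w) : Far R ρ w :=
  ⟨w, h, hE ρ w w h h⟩

/-- The intermediate worlds `u` and `y` are both successors of `ρ`, so `y` sees `u`; then `u` and
`x`, seen from `y`, give `R u x`, and `w` and `x`, seen from `u`, give `R w x`. -/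
theorem rel_of_far (hE : Euclidean R) (hw : Far R ρ w) (hx : Far R ρ x) : R w x := by
  obtain ⟨u, hu, huw⟩ := hw
  obtain ⟨y, hy, hyx⟩ := hx
  exact hE u w x huw (hE y u x (hE ρ y u hy hu) hyx)

theorem far_trans (hE : Euclidean R) (hw : Far R ρ w) (h : R w x) : Far R ρ x := by
  obtain ⟨u, hu, huw⟩ := hw
  exact ⟨u, hu, hE w u x (hE.rel_of_far ⟨u, hu, huw⟩ (hE.far_of_rel hu)) h⟩

end Euclidean

/-! ### Refutation of sequents and its link with the formula interpretation. -/

section Refutation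

variable {Pr : Type v} {W : Type}

/-- Every formula of `S` is false at `w`. -/
def KripkeModel.Falsifies (M : KripkeModel Pr W) (w : W) (S : Multiset (Formula Pr)) : Prop :=
  ∀ φ ∈ S, ¬ M.Sat w φ

@[simp]
theorem KripkeModel.falsifies_add (M : KripkeModel Pr W) (w : W) (S T : Multiset (Formula Pr)) :
    M.Falsifies w (S + T) ↔ M.Falsifies w S ∧ M.Falsifies w T := by
  simp [KripkeModel.Falsifies, or_imp, forall_and]

@[simp]
theorem KripkeModel.falsifies_cons (M : KripkeModel Pr W) (w : W) (φ : Formula Pr)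
    (S : Multiset (Formula Pr)) :
    M.Falsifies w (φ ::ₘ S) ↔ ¬ M.Sat w φ ∧ M.Falsifies w S := by
  simp [KripkeModel.Falsifies]

@[simp]
theorem KripkeModel.falsifies_singleton (M : KripkeModel Pr W) (w : W) (φ : Formula Pr) :
    M.Falsifies w {φ} ↔ ¬ M.Sat w φ := by
  simp [KripkeModel.Falsifies]

/-- The worlds at which components of the two kinds are evaluated. -/
def Locus (R : W → W → Prop) (ρ : W) (D : W → Prop) : Bracket → W → Prop
  | .single => R ρ
  | .double => D

/-- Every component of `G` is falsified: the trunk at `ρ`, each `[ ]`-component at a successor of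
`ρ`, and each `[[ ]]`-component at a world satisfying `D`. -/
def Refutes (M : KripkeModel Pr W) (ρ : W) (D : W → Prop) (G : Sequent Pr) : Prop :=
  M.Falsifies ρ (G.trunk.getD 0) ∧ (∀ S ∈ G.single, ∃ w, M.R ρ w ∧ M.Falsifies w S) ∧
    ∀ S ∈ G.double, ∃ w, D w ∧ M.Falsifies w S

variable {M : KripkeModel Pr W} {ρ : W} {D : W → Prop}

@[simp]
theorem refutes_addTrunk (G : Sequent Pr) (S : Multiset (Formula Pr)) :
    Refutes M ρ D (G.addTrunk S) ↔ Refutes M ρ D G ∧ M.Falsifies ρ S := by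
  simp only [Refutes, Sequent.addTrunk, Option.getD_some, KripkeModel.falsifies_add]
  tauto

@[simp]
theorem refutes_addComp (G : Sequent Pr) (b : Bracket) (S : Multiset (Formula Pr)) :
    Refutes M ρ D (G.addComp b S) ↔
      Refutes M ρ D G ∧ ∃ w, Locus M.R ρ D b w ∧ M.Falsifies w S := by
  cases b <;> simp only [Refutes, Sequent.addComp, Multiset.mem_cons, forall_eq_or_imp, Locus] <;>
    tauto

theorem sat_disjList (w : W) (l : List (Formula Pr)) :
    M.Sat w (disjList l) ↔ ∃ φ ∈ l, M.Sat w φ := by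
  induction l with
  | nil => simp [disjList, KripkeModel.Sat]
  | cons a l ih =>
    have h : disjList (a :: l) = .or a (disjList l) := rfl
    simp [h, KripkeModel.Sat, ih]

theorem sat_disj (w : W) (S : Multiset (Formula Pr)) :
    M.Sat w (disj S) ↔ ¬ M.Falsifies w S := by
  simp [disj, sat_disjList, KripkeModel.Falsifies]

/-- Each disjunct of `iota` fails at its own witness, so components are falsified independently; the
two boxes of a `[[ ]]`-component make its witness a world two steps away. -/
theorem not_sat_iota (G : Sequent Pr) :
    ¬ M.Sat ρ G.iota ↔ Refutes M ρ (Far M.R ρ) G := by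
  have h1 : ¬ M.Sat ρ (disj (G.single.map fun S => .box (disj S))) ↔
      ∀ S ∈ G.single, ∃ w, M.R ρ w ∧ M.Falsifies w S := by
    simp [sat_disj, KripkeModel.Falsifies, KripkeModel.Sat]
  have h2 : ¬ M.Sat ρ (disj (G.double.map fun S => .box (.box (disj S)))) ↔
      ∀ S ∈ G.double, ∃ w, Far M.R ρ w ∧ M.Falsifies w S := by
    simp only [sat_disj, not_not, Far]
    simp only [KripkeModel.Falsifies, Multiset.mem_map, forall_exists_index, and_imp,
      forall_apply_eq_imp_iff₂, KripkeModel.Sat, sat_disj, not_forall, not_not]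
    refine forall₂_congr fun S _ => ⟨?_, ?_⟩
    · rintro ⟨u, hu, w, hw, h⟩
      exact ⟨w, ⟨u, hu, hw⟩, fun φ hφ hs => h ⟨φ, hφ, hs⟩⟩
    · rintro ⟨w, ⟨u, hu, hw⟩, h⟩
      exact ⟨u, hu, w, hw, fun ⟨φ, hφ, hs⟩ => h φ hφ hs⟩
  simp only [Sequent.iota, KripkeModel.Sat, not_or, h1, h2]
  simp [Refutes, sat_disj]

end Refutation

section Labels

variable {Pr : Type v}

theorem trunk_eq_component (G : Sequent Pr) (h) : G.trunk = some (G.component (.trunk h)) := by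
  simp [Sequent.component]

theorem component_single_mem (G : Sequent Pr) (i) : G.component (.single i) ∈ G.single :=
  Multiset.mem_toList.1 (List.get_mem _ i)

theorem component_double_mem (G : Sequent Pr) (i) : G.component (.double i) ∈ G.double :=
  Multiset.mem_toList.1 (List.get_mem _ i)

theorem exists_single_label {G : Sequent Pr} {S : Multiset (Formula Pr)} (hS : S ∈ G.single) :
    ∃ i, G.component (.single i) = S := by
  obtain ⟨i, hi⟩ := List.mem_iff_get.1 (Multiset.mem_toList.2 hS)
  exact ⟨i, hi⟩

theorem exists_double_label {G : Sequent Pr} {S : Multiset (Formula Pr)} (hS : S ∈ G.double) :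
    ∃ i, G.component (.double i) = S := by
  obtain ⟨i, hi⟩ := List.mem_iff_get.1 (Multiset.mem_toList.2 hS)
  exact ⟨i, hi⟩

end Labels

/-! ### Soundness: from derivations to valid formulas to valid sequents. -/

section Soundness

variable {Pr : Type v} {W : Type}

/-- In the logics with the rule `boxC`, worlds two steps from the root are seen by the root. -/
theorem IsFrame.rel_of_far {L : Logic} {R : W → W → Prop} {ρ w : W} (hF : IsFrame L R ρ)
    (hL : RuleName.boxC ∈ rules L) (hw : Far R ρ w) : R ρ w := by
  have hE := hF.1
  have single : SingleFrame R ρ → R ρ w := by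
    rintro ⟨h, hn⟩
    obtain ⟨u, hu, -⟩ := hw
    exact absurd (h u ▸ hu) hn
  have rootAll : RootAllClusterFrame R ρ → R ρ w := by
    rintro ⟨hn, C, -, -, hC, hR⟩
    rcases hC w with rfl | h
    · exact absurd (hE.rel_of_far hw hw) hn
    · exact hR w h
  have cluster : ClusterFrame R → R ρ w := fun h => h.2.2 ρ trivial w trivial
  obtain ⟨-, hS⟩ := hF
  cases L <;> simp only [FrameShape] at hS
  · simp [rules, commonRules] at hL
  · simp [rules, commonRules] at hL
  · exact hS.elim single rootAll
  · exact rootAll hS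
  · exact hS.elim single cluster
  · exact cluster hS

theorem RootAllClusterFrame.rootCluster {R : W → W → Prop} {ρ : W}
    (h : RootAllClusterFrame R ρ) : RootClusterFrame R ρ := by
  obtain ⟨hn, C, hC, hρ, hall, hR⟩ := h
  obtain ⟨w, hw⟩ := hC.1
  exact ⟨hn, C, hC, hρ, hall, w, hw, hR w hw⟩

theorem IsFrame.exists_rel {L : Logic} {R : W → W → Prop} {ρ : W} (hF : IsFrame L R ρ)
    (hL : RuleName.dT ∈ rules L) : ∃ w, R ρ w := by
  have rootCluster : RootClusterFrame R ρ → ∃ w, R ρ w := by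
    rintro ⟨-, C, -, -, -, w, -, h⟩
    exact ⟨w, h⟩
  obtain ⟨-, hS⟩ := hF
  cases L <;> simp only [FrameShape] at hS
  case KD5 => exact rootCluster hS
  case KD45 => exact rootCluster hS.rootCluster
  all_goals simp [rules, commonRules] at hL

variable {M : KripkeModel Pr W} {ρ : W} {D : W → Prop}

/-- `P` and `Q` do not depend on what fills the hole, so each propositional rule reduces to an
argument at one world, wherever the hole is. -/
theorem Context.exists_refutes_fill_iff (K : Context Pr) (M : KripkeModel Pr W) (ρ : W)
    (D : W → Prop) : ∃ (P : Prop) (Q : W → Prop), ∀ S,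
      Refutes M ρ D (K.fill S) ↔ P ∧ ∃ w, Q w ∧ M.Falsifies w S := by
  cases K with
  | trunk G => exact ⟨Refutes M ρ D G, (· = ρ), fun S => by simp [Context.fill]⟩
  | crown G b T =>
    exact ⟨Refutes M ρ D G, fun w => Locus M.R ρ D b w ∧ M.Falsifies w T, fun S => by
      simp [Context.fill, and_assoc]⟩

theorem Locus.far {R : W → W → Prop} (hE : Euclidean R) {b : Bracket} {w : W}
    (h : Locus R ρ (Far R ρ) b w) : Far R ρ w := by
  cases b
  · exact hE.far_of_rel h
  · exact h

/-- All crown components are falsified inside one cluster, so diamonds reach every other component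
and box witnesses stay in the cluster. The `d` rules take their new world from a successor of the
root. -/
theorem Rule.exists_refutes_premise {L : Logic} (hF : IsFrame L M.R ρ) {r : RuleName}
    (hr : r ∈ rules L) {ps : List (Sequent Pr)} {c : Sequent Pr} (h : Rule r ps c)
    (hc : Refutes M ρ (Far M.R ρ) c) :
    ∃ p ∈ ps, ∃ ρ', IsFrame L M.R ρ' ∧ Refutes M ρ' (Far M.R ρ') p := by
  have hE := hF.1
  cases h with
  | idP K p =>
    obtain ⟨P, Q, h⟩ := K.exists_refutes_fill_iff M ρ (Far M.R ρ)
    rw [h] at hc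
    obtain ⟨-, w, -, hw⟩ := hc
    simp [KripkeModel.Sat] at hw
  | idTop K =>
    obtain ⟨P, Q, h⟩ := K.exists_refutes_fill_iff M ρ (Far M.R ρ)
    rw [h] at hc
    obtain ⟨-, w, -, hw⟩ := hc
    simp [KripkeModel.Sat] at hw
  | and K φ ψ =>
    obtain ⟨P, Q, h⟩ := K.exists_refutes_fill_iff M ρ (Far M.R ρ)
    rw [h] at hc
    obtain ⟨hP, w, hQ, hw⟩ := hc
    by_cases hφ : M.Sat w φ
    · refine ⟨K.fill {.and φ ψ, ψ}, by simp, ρ, hF, (h _).2 ⟨hP, w, hQ, ?_⟩⟩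
      simp_all [KripkeModel.Sat]
    · refine ⟨K.fill {.and φ ψ, φ}, by simp, ρ, hF, (h _).2 ⟨hP, w, hQ, ?_⟩⟩
      simp_all [KripkeModel.Sat]
  | or K φ ψ =>
    obtain ⟨P, Q, h⟩ := K.exists_refutes_fill_iff M ρ (Far M.R ρ)
    rw [h] at hc
    obtain ⟨hP, w, hQ, hw⟩ := hc
    refine ⟨K.fill {.or φ ψ, φ, ψ}, by simp, ρ, hF, (h _).2 ⟨hP, w, hQ, ?_⟩⟩
    simp_all [KripkeModel.Sat]
  | boxT G φ =>
    refine ⟨_, List.mem_singleton_self _, ρ, hF, ?_⟩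
    simp_all [KripkeModel.Sat, Locus]
  | boxTPrime S φ =>
    refine ⟨_, List.mem_singleton_self _, ρ, hF, ?_⟩
    obtain ⟨hS, -, -⟩ := hc
    simp only [Option.getD_some] at hS
    have hφ : ∃ v, M.R ρ v ∧ ¬ M.Sat v φ := by
      simpa [KripkeModel.Sat] using hS (.box φ) (by simp)
    obtain ⟨v, hv, hφ⟩ := hφ
    have hL : RuleName.boxC ∈ rules L := by
      cases L <;> simp [rules, commonRules] at hr ⊢
    -- The rule turns the trunk into a `[ ]`-component, so the root must see itself in order to
    -- remain its witness.
    have hρ : M.R ρ ρ := by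
      obtain ⟨-, hFS⟩ := hF
      cases L <;> first | (simp [rules, commonRules] at hr; done) | skip
      rcases hFS with ⟨h, -⟩ | h
      · exact h v ▸ hv
      · exact h.2.2 ρ trivial ρ trivial
    refine ⟨by simp [KripkeModel.Falsifies], ?_, by simp⟩
    simp only [Multiset.insert_eq_cons, Multiset.mem_cons, Multiset.mem_singleton, forall_eq_or_imp,
      forall_eq]
    exact ⟨⟨ρ, hρ, hS⟩, v, hv, by simpa using hφ⟩
  | diaT G S φ =>
    refine ⟨_, List.mem_singleton_self _, ρ, hF, ?_⟩
    simp only [refutes_addComp, refutes_addTrunk, KripkeModel.falsifies_singleton,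
      KripkeModel.falsifies_add, KripkeModel.Sat, not_exists, not_and, Locus] at hc ⊢
    obtain ⟨⟨hG, hφ⟩, w, hw, hS⟩ := hc
    exact ⟨⟨hG, hφ⟩, w, hw, hS, hφ w hw⟩
  | boxC G b S φ =>
    refine ⟨_, List.mem_singleton_self _, ρ, hF, ?_⟩
    rw [refutes_addComp]
    refine ⟨hc, ?_⟩
    simp only [refutes_addComp, KripkeModel.falsifies_singleton,
      KripkeModel.falsifies_add, KripkeModel.Sat, not_forall] at hc ⊢
    obtain ⟨-, w, hw, -, v, hwv, hv⟩ := hc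
    -- The new component is a `[ ]`-component, so `v` must be seen by the root itself; the frames of
    -- logics with `boxC` ensure this.
    exact ⟨v, hF.rel_of_far hr (hE.far_trans (hw.far hE) hwv), hv⟩
  | boxCPrime G b S φ =>
    refine ⟨_, List.mem_singleton_self _, ρ, hF, ?_⟩
    rw [refutes_addComp]
    refine ⟨hc, ?_⟩
    simp only [refutes_addComp, KripkeModel.falsifies_singleton,
      KripkeModel.falsifies_add, KripkeModel.Sat, not_forall] at hc ⊢
    obtain ⟨-, w, hw, -, v, hwv, hv⟩ := hc
    exact ⟨v, hE.far_trans (hw.far hE) hwv, hv⟩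
  | diaC G b c S P φ =>
    refine ⟨_, List.mem_singleton_self _, ρ, hF, ?_⟩
    simp only [refutes_addComp, KripkeModel.falsifies_singleton,
      KripkeModel.falsifies_add, KripkeModel.Sat, not_exists, not_and] at hc ⊢
    obtain ⟨⟨hG, w, hw, hS, hφ⟩, v, hv, hP⟩ := hc
    exact ⟨⟨hG, w, hw, hS, hφ⟩, v, hv, hP, hφ v (hE.rel_of_far (hw.far hE) (hv.far hE))⟩
  | dT G φ =>
    refine ⟨_, List.mem_singleton_self _, ρ, hF, ?_⟩
    obtain ⟨v, hv⟩ := hF.exists_rel hr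
    simp only [refutes_addComp, refutes_addTrunk, KripkeModel.falsifies_singleton,
      KripkeModel.Sat, not_exists, not_and, Locus] at hc ⊢
    exact ⟨hc, v, hv, hc.2 v hv⟩
  | dC G b S φ =>
    refine ⟨_, List.mem_singleton_self _, ρ, hF, ?_⟩
    obtain ⟨v, hv⟩ := hF.exists_rel (by cases L <;> simp [rules, commonRules] at hr ⊢)
    rw [refutes_addComp]
    refine ⟨hc, v, hv, ?_⟩
    simp only [refutes_addComp, KripkeModel.falsifies_singleton,
      KripkeModel.falsifies_add, KripkeModel.Sat, not_exists, not_and] at hc ⊢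
    obtain ⟨-, w, hw, -, h⟩ := hc
    exact h v (hE.rel_of_far (hw.far hE) (hE.far_of_rel hv))
  | dCPrime G b S φ =>
    refine ⟨_, List.mem_singleton_self _, ρ, hF, ?_⟩
    obtain ⟨v, hv⟩ := hF.exists_rel (by cases L <;> simp [rules, commonRules] at hr ⊢)
    rw [refutes_addComp]
    refine ⟨hc, v, hE.far_of_rel hv, ?_⟩
    simp only [refutes_addComp, KripkeModel.falsifies_singleton,
      KripkeModel.falsifies_add, KripkeModel.Sat, not_exists, not_and] at hc ⊢
    obtain ⟨-, w, hw, -, h⟩ := hc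
    exact h v (hE.rel_of_far (hw.far hE) (hE.far_of_rel hv))
  | t G b S φ =>
    refine ⟨_, List.mem_singleton_self _, ρ, hF, ?_⟩
    simp only [refutes_addComp, KripkeModel.falsifies_singleton, Multiset.insert_eq_cons,
      KripkeModel.falsifies_add, KripkeModel.falsifies_cons, KripkeModel.Sat, not_exists,
      not_and] at hc ⊢
    obtain ⟨hG, w, hw, hS, hφ⟩ := hc
    exact ⟨hG, w, hw, hS, hφ, hφ w (hE.rel_of_far (hw.far hE) (hw.far hE))⟩

theorem Derivable.validFormula {L : Logic} {G : Sequent Pr} (h : Derivable L G) :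
    ValidFormula L G.iota := by
  induction h with
  | step hr hrule _ _ _ ih =>
    intro W M ρ hF
    by_contra hn
    obtain ⟨p, hp, ρ', hF', hp'⟩ :=
      hrule.exists_refutes_premise hF hr ((not_sat_iota _).1 hn)
    exact (not_sat_iota _).2 hp' (ih p hp W M ρ' hF')

theorem ValidFormula.validSequent {L : Logic} {G : Sequent Pr} (hG : G.IsLSequent L)
    (h : ValidFormula L G.iota) : ValidSequent L G := by
  intro W M ρ hF I hI
  by_contra hn
  simp only [SatSequent, not_exists, not_and] at hn
  refine (not_sat_iota (M := M) (ρ := ρ) G).2 ?_ (h W M ρ hF)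
  -- Without a trunk the interpretation says nothing about `ρ`. The logic is then KB5 or S5: in a
  -- cluster the root sees everything, and in a one-world frame `single_single` already gives the
  -- loop.
  have hρ : ∀ i, M.R ρ (I (.single i)) := by
    intro i
    by_cases ht : G.trunk.isSome
    · exact hI.trunk_root ht ▸ hI.trunk_single ht i
    · obtain ⟨-, hS⟩ := hG
      obtain ⟨-, hFS⟩ := hF
      cases L <;> simp only [Sequent.Shape, ht, FrameShape] at hS hFS <;>
        first | (simp at hS; done) | skip
      · rcases hFS with ⟨h1, -⟩ | h
        · have := hI.single_single i i
          rwa [h1 (I (.single i))] at this ⊢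
        · exact h.2.2 _ trivial _ trivial
      · exact hFS.2.2 _ trivial _ trivial
  refine ⟨?_, fun S hS => ?_, fun S hS => ?_⟩
  · cases ht : G.trunk with
    | none => simp [KripkeModel.Falsifies]
    | some Γ =>
      have ht' : G.trunk.isSome := by simp [ht]
      intro φ hφ
      rw [← hI.trunk_root ht']
      refine hn (.trunk ht') φ ?_
      simpa [Sequent.component, ht] using hφ
  · obtain ⟨i, rfl⟩ := exists_single_label hS
    exact ⟨_, hρ i, hn _⟩
  · obtain ⟨T, hT⟩ := Multiset.card_pos_iff_exists_mem.1
      (hG.1 (Multiset.card_pos_iff_exists_mem.2 ⟨S, hS⟩))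
    obtain ⟨i, -⟩ := exists_single_label hT
    obtain ⟨j, rfl⟩ := exists_double_label hS
    exact ⟨_, ⟨_, hρ i, (hI.single_double i j).1⟩, hn _⟩

end Soundness

/-! ### Countermodels from saturated sequents. -/

section Countermodels

variable {Pr : Type v}

/-- `G` is refuted in some `L`-model, with the `[[ ]]`-components at worlds that the root does not
see. -/
def HasCountermodel (L : Logic) (G : Sequent Pr) : Prop :=
  ∃ (W : Type) (M : KripkeModel Pr W) (ρ : W), IsFrame L M.R ρ ∧
    Refutes M ρ (fun w => Far M.R ρ w ∧ ¬ M.R ρ w) G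

theorem HasCountermodel.mono {L : Logic} {G H : Sequent Pr} (h : HasCountermodel L G)
    (hGH : ∀ (W : Type) (M : KripkeModel Pr W) (ρ : W) (D : W → Prop),
      Refutes M ρ D G → Refutes M ρ D H) : HasCountermodel L H := by
  obtain ⟨W, M, ρ, hF, hR⟩ := h
  exact ⟨W, M, ρ, hF, hGH _ _ _ _ hR⟩

/-- The falsifying worlds, one chosen for each label, form an interpretation: the unseen clause is
what `trunk_double` asks, and the cluster property supplies the relations inside the crown. -/
theorem HasCountermodel.not_validSequent {L : Logic} {G : Sequent Pr}
    (h : HasCountermodel L G) : ¬ ValidSequent L G := by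
  obtain ⟨W, M, ρ, hF, ht, hs, hd⟩ := h
  have hE := hF.1
  intro hv
  choose f hf using fun i : Fin G.single.toList.length =>
    hs _ (Multiset.mem_toList.1 (List.get_mem G.single.toList i))
  choose g hg using fun i : Fin G.double.toList.length =>
    hd _ (Multiset.mem_toList.1 (List.get_mem G.double.toList i))
  let I : Lab G → W
    | .trunk _ => ρ
    | .single i => f i
    | .double j => g j
  have hI : IsInterpretation G M ρ I :=
    { trunk_root := fun _ => rfl
      trunk_single := fun _ i => (hf i).1
      single_double := fun i j =>
        ⟨hE.rel_of_far (hE.far_of_rel (hf i).1) (hg j).1.1,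
          hE.rel_of_far (hg j).1.1 (hE.far_of_rel (hf i).1)⟩
      trunk_double := fun _ j => (hg j).1.2
      single_single := fun i j => hE _ _ _ (hf i).1 (hf j).1 }
  obtain ⟨σ, φ, hφ, hsat⟩ := hv W M ρ hF I hI
  cases σ with
  | trunk h =>
    refine ht φ ?_ hsat
    obtain ⟨Γ, hΓ⟩ := Option.isSome_iff_exists.1 h
    simpa [Sequent.component, hΓ] using hφ
  | single i => exact (hf i).2 φ hφ hsat
  | double j => exact (hg j).2 φ hφ hsat

/-- `S` is a component of `G`. -/
def Sequent.IsComponent (G : Sequent Pr) (S : Multiset (Formula Pr)) : Prop :=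
  G.trunk = some S ∨ S ∈ G.single + G.double

/-- `G` is closed under backward applications of the rules. -/
structure Saturated (G : Sequent Pr) : Prop where
  top : ∀ S, G.IsComponent S → .top ∉ S
  atom : ∀ S, G.IsComponent S → ∀ p, .atom p ∈ S → .natom p ∉ S
  and : ∀ S, G.IsComponent S → ∀ φ ψ, .and φ ψ ∈ S → φ ∈ S ∨ ψ ∈ S
  or : ∀ S, G.IsComponent S → ∀ φ ψ, .or φ ψ ∈ S → φ ∈ S ∧ ψ ∈ S
  boxTrunk : ∀ S, G.trunk = some S → ∀ φ, .box φ ∈ S → ∃ T ∈ G.single, φ ∈ T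
  diaTrunk : ∀ S, G.trunk = some S → ∀ φ, .dia φ ∈ S → ∀ T ∈ G.single, φ ∈ T
  boxCrown : ∀ S ∈ G.single + G.double, ∀ φ, .box φ ∈ S → ∃ T ∈ G.single + G.double, φ ∈ T
  diaCrown : ∀ S ∈ G.single + G.double, ∀ φ, .dia φ ∈ S → ∀ T ∈ G.single + G.double, φ ∈ T

/-- The accessibility relation between labels. -/
def labRel (G : Sequent Pr) : Lab G → Lab G → Prop
  | .trunk _, .single _ => True
  | .trunk _, _ => False
  | _, .trunk _ => False
  | _, _ => True

/-- The model whose worlds are the labels of `G` and where an atom is true unless it occurs in the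
component. -/
noncomputable def labModel (G : Sequent Pr) : KripkeModel Pr (Lab G) where
  R := labRel G
  V p := {σ | .atom p ∉ G.component σ}

theorem isComponent_component (G : Sequent Pr) (σ : Lab G) : G.IsComponent (G.component σ) := by
  cases σ with
  | trunk h => exact Or.inl (trunk_eq_component G h)
  | single i => exact Or.inr (Multiset.mem_add.2 (Or.inl (component_single_mem G i)))
  | double i => exact Or.inr (Multiset.mem_add.2 (Or.inr (component_double_mem G i)))

/-- Induction on the formula. The saturation clauses mirror `labRel`: the trunk looks only at `[
]`-components, while a crown label sees every crown label, so a box witness there may have either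
bracket. -/
theorem Saturated.labModel_falsifies {G : Sequent Pr} (hG : Saturated G) (φ : Formula Pr) :
    ∀ σ, φ ∈ G.component σ → ¬ (labModel G).Sat σ φ := by
  induction φ with
  | top => exact fun σ h => absurd h (hG.top _ (isComponent_component G σ))
  | bot => exact fun σ _ h => h
  | atom p => exact fun σ h hs => hs h
  | natom p =>
    intro σ h hs
    exact hs fun h' => hG.atom _ (isComponent_component G σ) p h' h
  | and φ ψ ihφ ihψ =>
    intro σ h hs
    rcases hG.and _ (isComponent_component G σ) φ ψ h with h | h
    · exact ihφ σ h hs.1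
    · exact ihψ σ h hs.2
  | or φ ψ ihφ ihψ =>
    intro σ h hs
    obtain ⟨h1, h2⟩ := hG.or _ (isComponent_component G σ) φ ψ h
    exact hs.elim (ihφ σ h1) (ihψ σ h2)
  | box φ ih =>
    intro σ h hs
    have crown : G.component σ ∈ G.single + G.double → (∀ i, labRel G σ (.single i)) →
        (∀ i, labRel G σ (.double i)) → False := by
      intro hσ h1 h2
      obtain ⟨T, hT, hφ⟩ := hG.boxCrown _ hσ φ h
      rcases Multiset.mem_add.1 hT with hT | hT
      · obtain ⟨i, rfl⟩ := exists_single_label hT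
        exact ih _ hφ (hs _ (h1 i))
      · obtain ⟨i, rfl⟩ := exists_double_label hT
        exact ih _ hφ (hs _ (h2 i))
    cases σ with
    | trunk ht =>
      obtain ⟨T, hT, hφ⟩ := hG.boxTrunk _ (trunk_eq_component G ht) φ h
      obtain ⟨i, rfl⟩ := exists_single_label hT
      exact ih _ hφ (hs _ trivial)
    | single i =>
      exact crown (Multiset.mem_add.2 (Or.inl (component_single_mem G i))) (fun _ => trivial)
        fun _ => trivial
    | double i =>
      exact crown (Multiset.mem_add.2 (Or.inr (component_double_mem G i))) (fun _ => trivial)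
        fun _ => trivial
  | dia φ ih =>
    rintro σ h ⟨τ, hτ, hs⟩
    refine ih τ ?_ hs
    have hcs := fun i => Multiset.mem_add.2 (Or.inl (component_single_mem G i) : _ ∨ _ ∈ G.double)
    have hcd := fun i => Multiset.mem_add.2 (Or.inr (component_double_mem G i) : _ ∈ G.single ∨ _)
    rcases σ with ht | i | i <;> rcases τ with ht' | j | j <;>
      first
      | exact hτ.elim
      | exact hG.diaTrunk _ (trunk_eq_component G ht) φ h _ (component_single_mem G j)
      | exact hG.diaCrown _ (hcs i) φ h _ (hcs j)
      | exact hG.diaCrown _ (hcs i) φ h _ (hcd j)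
      | exact hG.diaCrown _ (hcd i) φ h _ (hcs j)
      | exact hG.diaCrown _ (hcd i) φ h _ (hcd j)

theorem euclidean_labRel (G : Sequent Pr) : Euclidean (labRel G) := by
  rintro (_ | _ | _) (_ | _ | _) (_ | _ | _) <;> simp [labRel]

theorem finite_lab (G : Sequent Pr) : Finite (Lab G) := by
  refine Finite.of_injective (β := Option (Fin G.single.toList.length ⊕ Fin G.double.toList.length))
    (fun | .trunk _ => none | .single i => some (.inl i) | .double i => some (.inr i)) ?_
  rintro (_ | _ | _) (_ | _ | _) <;> simp

theorem singleFrame_labRel {G : Sequent Pr} (ht : G.trunk.isSome) (hs : G.single = 0)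
    (hd : G.double = 0) : SingleFrame (labRel G) (.trunk ht) := by
  refine ⟨?_, fun h => h⟩
  rintro (_ | i | i)
  · rfl
  · exact absurd (component_single_mem G i) (by simp [hs])
  · exact absurd (component_double_mem G i) (by simp [hd])

theorem isFiniteCluster_labRel {G : Sequent Pr} (hs : G.single ≠ 0) :
    IsFiniteCluster (labRel G) {σ | ∀ ht, σ ≠ .trunk ht} := by
  obtain ⟨S, hS⟩ := Multiset.exists_mem_of_ne_zero hs
  obtain ⟨i, -⟩ := exists_single_label hS
  have := finite_lab G
  refine ⟨⟨.single i, by simp⟩, Set.toFinite _, ?_⟩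
  rintro (_ | _ | _) hσ (_ | _ | _) hτ <;> simp_all [labRel]

theorem rootClusterFrame_labRel {G : Sequent Pr} (ht : G.trunk.isSome) (hs : G.single ≠ 0) :
    RootClusterFrame (labRel G) (.trunk ht) := by
  obtain ⟨S, hS⟩ := Multiset.exists_mem_of_ne_zero hs
  obtain ⟨i, -⟩ := exists_single_label hS
  refine ⟨fun h => h, _, isFiniteCluster_labRel hs, fun h => h ht rfl, ?_, .single i, by simp,
    trivial⟩
  rintro (_ | _ | _) <;> simp

theorem rootAllClusterFrame_labRel {G : Sequent Pr} (ht : G.trunk.isSome) (hs : G.single ≠ 0)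
    (hd : G.double = 0) : RootAllClusterFrame (labRel G) (.trunk ht) := by
  refine ⟨fun h => h, _, isFiniteCluster_labRel hs, fun h => h ht rfl, ?_, ?_⟩
  · rintro (_ | _ | _) <;> simp
  · rintro (_ | i | i) h
    · exact absurd rfl (h ht)
    · trivial
    · exact absurd (component_double_mem G i) (by simp [hd])

theorem clusterFrame_labRel {G : Sequent Pr} (ht : G.trunk = none) (hs : G.single ≠ 0) :
    ClusterFrame (labRel G) := by
  have h : {σ : Lab G | ∀ ht, σ ≠ .trunk ht} = Set.univ := by
    ext σ
    simp [ht]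
  rw [ClusterFrame, ← h]
  exact isFiniteCluster_labRel hs

/-- The root is the trunk label if there is one, and any `[ ]`-label otherwise. The hypothesis
`hser` excludes an irreflexive single world as frame of a serial logic. -/
theorem Saturated.hasCountermodel {L : Logic} {G : Sequent Pr} (hG : Saturated G)
    (hL : G.IsLSequent L) (hser : RuleName.dT ∈ rules L → G.single ≠ 0) :
    HasCountermodel L G := by
  have key : ∃ ρ : Lab G, IsFrame L (labRel G) ρ ∧ (∀ ht, ρ = .trunk ht) ∧
      (∀ i, labRel G ρ (.single i)) ∧
      ((∃ ht, ρ = .trunk ht) ∨ G.trunk = none ∧ G.double = 0) := by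
    obtain ⟨hlay, hS⟩ := hL
    have hdouble : G.single = 0 → G.double = 0 := fun h => by
      by_contra hd
      have := hlay (Multiset.card_pos.2 hd)
      simp [h] at this
    by_cases ht : G.trunk.isSome
    · refine ⟨.trunk ht, ⟨euclidean_labRel G, ?_⟩, fun _ => rfl, fun _ => trivial,
        Or.inl ⟨ht, rfl⟩⟩
      by_cases hs : G.single = 0 <;>
      cases L <;> simp only [Sequent.Shape] at hS <;> simp only [FrameShape]
      case pos.K5 | pos.K45 | pos.KB5 => exact Or.inl (singleFrame_labRel ht hs (hdouble hs))
      case pos.KD5 | pos.KD45 => exact absurd hs (hser (by simp [rules, commonRules]))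
      case neg.K5 => exact Or.inr (rootClusterFrame_labRel ht hs)
      case neg.KD5 => exact rootClusterFrame_labRel ht hs
      case neg.K45 => exact Or.inr (rootAllClusterFrame_labRel ht hs hS.2)
      case neg.KD45 => exact rootAllClusterFrame_labRel ht hs hS.2
      case neg.KB5 => exact absurd (hS.resolve_left (by simp_all)).2.1 hs
      all_goals simp_all
    · have hL : G.trunk = none ∧ G.single ≠ 0 ∧ G.double = 0 ∧ (L = .KB5 ∨ L = .S5) := by
        cases L <;> simp_all [Sequent.Shape]
        all_goals
          rintro h
          simp [h] at hS
      obtain ⟨ht, hs, hd, hL⟩ := hL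
      obtain ⟨S, hS⟩ := Multiset.exists_mem_of_ne_zero hs
      obtain ⟨i, -⟩ := exists_single_label hS
      refine ⟨.single i, ⟨euclidean_labRel G, ?_⟩, by simp [ht], fun _ => trivial,
        Or.inr ⟨ht, hd⟩⟩
      rcases hL with rfl | rfl
      · exact Or.inr (clusterFrame_labRel ht hs)
      · exact clusterFrame_labRel ht hs
  obtain ⟨ρ, hF, hroot, hsing, hdoub⟩ := key
  have hfalse := fun σ φ h => hG.labModel_falsifies φ σ h
  refine ⟨Lab G, labModel G, ρ, hF, ?_, fun S hS => ?_, fun S hS => ?_⟩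
  · cases ht : G.trunk with
    | none => simp [KripkeModel.Falsifies]
    | some Γ =>
      obtain rfl := hroot (by simp [ht])
      exact fun φ hφ => hfalse _ _ (by simpa [Sequent.component, ht] using hφ)
  · obtain ⟨i, rfl⟩ := exists_single_label hS
    exact ⟨_, hsing i, hfalse _⟩
  · obtain ⟨T, hT⟩ := Multiset.card_pos_iff_exists_mem.1
      (hL.1 (Multiset.card_pos_iff_exists_mem.2 ⟨S, hS⟩))
    obtain ⟨i, -⟩ := exists_single_label hT
    obtain ⟨j, rfl⟩ := exists_double_label hS
    refine ⟨.double j, ⟨⟨_, hsing i, trivial⟩, ?_⟩, hfalse _⟩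
    rcases hdoub with ⟨ht, rfl⟩ | ⟨-, hd⟩
    · exact fun h => h
    · simp [hd] at hS

end Countermodels

/-! ### Finite subformula closure and the termination measure. -/

section Measure

variable {Pr : Type v}

/-- `F` is closed under immediate subformulas. -/
structure SubformulaClosed (F : Finset (Formula Pr)) : Prop where
  and : ∀ φ ψ, .and φ ψ ∈ F → φ ∈ F ∧ ψ ∈ F
  or : ∀ φ ψ, .or φ ψ ∈ F → φ ∈ F ∧ ψ ∈ F
  box : ∀ φ, .box φ ∈ F → φ ∈ F
  dia : ∀ φ, .dia φ ∈ F → φ ∈ F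

open Classical in
theorem SubformulaClosed.union {F F' : Finset (Formula Pr)} (h : SubformulaClosed F)
    (h' : SubformulaClosed F') : SubformulaClosed (F ∪ F') := by
  constructor <;> simp only [Finset.mem_union] <;> intros <;>
    grind [SubformulaClosed]

open Classical in
theorem exists_subformulaClosed (φ : Formula Pr) :
    ∃ F : Finset (Formula Pr), SubformulaClosed F ∧ φ ∈ F := by
  induction φ with
  | top => exact ⟨{.top}, by constructor <;> simp, by simp⟩
  | bot => exact ⟨{.bot}, by constructor <;> simp, by simp⟩
  | atom p => exact ⟨{.atom p}, by constructor <;> simp, by simp⟩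
  | natom p => exact ⟨{.natom p}, by constructor <;> simp, by simp⟩
  | and φ ψ ihφ ihψ =>
    obtain ⟨F, hF, hφ⟩ := ihφ
    obtain ⟨F', hF', hψ⟩ := ihψ
    have h := hF.union hF'
    refine ⟨insert (.and φ ψ) (F ∪ F'), ?_, by simp⟩
    constructor <;> grind [SubformulaClosed]
  | or φ ψ ihφ ihψ =>
    obtain ⟨F, hF, hφ⟩ := ihφ
    obtain ⟨F', hF', hψ⟩ := ihψ
    have h := hF.union hF'
    refine ⟨insert (.or φ ψ) (F ∪ F'), ?_, by simp⟩
    constructor <;> grind [SubformulaClosed]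
  | box φ ih =>
    obtain ⟨F, hF, hφ⟩ := ih
    refine ⟨insert (.box φ) F, ?_, by simp⟩
    constructor <;> grind [SubformulaClosed]
  | dia φ ih =>
    obtain ⟨F, hF, hφ⟩ := ih
    refine ⟨insert (.dia φ) F, ?_, by simp⟩
    constructor <;> grind [SubformulaClosed]

open Classical in
theorem exists_subformulaClosed_multiset (S : Multiset (Formula Pr)) :
    ∃ F : Finset (Formula Pr), SubformulaClosed F ∧ ∀ φ ∈ S, φ ∈ F := by
  induction S using Multiset.induction with
  | empty => exact ⟨∅, by constructor <;> simp, by simp⟩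
  | cons φ S ih =>
    obtain ⟨F, hF, hS⟩ := ih
    obtain ⟨F', hF', hφ⟩ := exists_subformulaClosed φ
    exact ⟨F ∪ F', hF.union hF', by grind⟩

/-- All formulas of `G` lie in `F`. -/
def Sequent.Bounded (F : Finset (Formula Pr)) (G : Sequent Pr) : Prop :=
  ∀ S, G.IsComponent S → ∀ φ ∈ S, φ ∈ F

theorem exists_bounded (G : Sequent Pr) :
    ∃ F : Finset (Formula Pr), SubformulaClosed F ∧ G.Bounded F := by
  obtain ⟨F, hF, h⟩ :=
    exists_subformulaClosed_multiset (G.trunk.getD 0 + G.single.sum + G.double.sum)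
  refine ⟨F, hF, fun S hS φ hφ => h φ ?_⟩
  simp only [Multiset.mem_add]
  rcases hS with hS | hS
  · simp [hS, hφ]
  · rcases Multiset.mem_add.1 hS with hS | hS
    · exact Or.inl (Or.inr (Multiset.mem_of_le (Multiset.single_le_sum (by simp) _ hS) hφ))
    · exact Or.inr (Multiset.mem_of_le (Multiset.single_le_sum (by simp) _ hS) hφ)

open Classical in
/-- The number of formulas of `F` without the property `P`. -/
noncomputable def missing (F : Finset (Formula Pr)) (P : Formula Pr → Prop) : ℕ :=
  (F.filter fun φ => ¬ P φ).card

theorem missing_anti (F : Finset (Formula Pr)) {P Q : Formula Pr → Prop} (h : ∀ φ, P φ → Q φ) :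
    missing F Q ≤ missing F P := by
  classical
  exact Finset.card_le_card fun φ => by
    simp only [Finset.mem_filter]
    exact fun ⟨h1, h2⟩ => ⟨h1, fun h3 => h2 (h φ h3)⟩

theorem missing_lt {F : Finset (Formula Pr)} {P Q : Formula Pr → Prop} (h : ∀ φ, P φ → Q φ)
    {φ : Formula Pr} (hF : φ ∈ F) (hQ : Q φ) (hP : ¬ P φ) : missing F Q < missing F P := by
  classical
  refine Finset.card_lt_card ⟨fun φ => ?_, fun hsub => ?_⟩
  · simp only [Finset.mem_filter]
    exact fun ⟨h1, h2⟩ => ⟨h1, fun h3 => h2 (h φ h3)⟩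
  · have := @hsub φ (by simp [hF, hP])
    simp [hQ] at this

theorem missing_le_card (F : Finset (Formula Pr)) (P : Formula Pr → Prop) :
    missing F P ≤ F.card := by
  classical
  exact Finset.card_filter_le _ _

/-- The number of formulas of `F` in no `[ ]`-component plus the number of those in no
`[[ ]]`-component. -/
noncomputable def crownMissing (F : Finset (Formula Pr)) (G : Sequent Pr) : ℕ :=
  missing F (fun φ => ∃ S ∈ G.single, φ ∈ S) + missing F (fun φ => ∃ S ∈ G.double, φ ∈ S)

/-- The total number of formulas of `F` missing from the components. -/
noncomputable def componentMissing (F : Finset (Formula Pr)) (G : Sequent Pr) : ℕ :=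
  (G.trunk.elim 0 fun S => missing F (· ∈ S)) + (G.single.map fun S => missing F (· ∈ S)).sum +
    (G.double.map fun S => missing F (· ∈ S)).sum

/-- A termination measure for backward proof search. -/
noncomputable def searchMeasure (F : Finset (Formula Pr)) (G : Sequent Pr) : ℕ :=
  (F.card + 1) * crownMissing F G + componentMissing F G

/-- A new component may add up to `F.card` missing formulas; the weight `F.card + 1` lets a single
unit of `crownMissing` outweigh them. -/
theorem searchMeasure_lt_of_crownMissing_lt {F : Finset (Formula Pr)} {G H : Sequent Pr}
    (h : crownMissing F H < crownMissing F G)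
    (h' : componentMissing F H ≤ componentMissing F G + F.card) :
    searchMeasure F H < searchMeasure F G := by
  have := Nat.mul_le_mul_left (F.card + 1) h
  rw [Nat.mul_succ] at this
  simp only [searchMeasure]
  omega

theorem searchMeasure_lt_of_componentMissing_lt {F : Finset (Formula Pr)} {G H : Sequent Pr}
    (h : crownMissing F H ≤ crownMissing F G)
    (h' : componentMissing F H < componentMissing F G) :
    searchMeasure F H < searchMeasure F G := by
  have := Nat.mul_le_mul_left (F.card + 1) h
  simp only [searchMeasure]
  omega

/-- The components inside brackets of the given kind. -/
def Sequent.comps (G : Sequent Pr) : Bracket → Multiset (Multiset (Formula Pr))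
  | .single => G.single
  | .double => G.double

/-- The two brackets are counted separately in `crownMissing`, so it suffices that `φ` is new among
components of kind `b`. -/
theorem searchMeasure_addComp_lt {F : Finset (Formula Pr)} {G : Sequent Pr} {b : Bracket}
    {φ : Formula Pr} (hF : φ ∈ F) (h : ∀ S ∈ G.comps b, φ ∉ S) :
    searchMeasure F (G.addComp b {φ}) < searchMeasure F G := by
  have hle := missing_le_card F (· ∈ ({φ} : Multiset (Formula Pr)))
  have hlt := missing_lt (F := F) (P := fun ψ => ∃ S ∈ G.comps b, ψ ∈ S)
    (Q := fun ψ => ∃ S ∈ {φ} ::ₘ G.comps b, ψ ∈ S)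
    (fun ψ ⟨S, hS, hψ⟩ => ⟨S, Multiset.mem_cons_of_mem hS, hψ⟩) hF (by simp)
    (fun ⟨S, hS, hφ⟩ => h S hS hφ)
  refine searchMeasure_lt_of_crownMissing_lt ?_ ?_
  · cases b <;> simp only [crownMissing, Sequent.addComp, Sequent.comps] at hlt ⊢ <;> omega
  · cases b <;> simp only [componentMissing, Sequent.addComp, Multiset.map_cons,
      Multiset.sum_cons] <;> omega

/-- Moving `S` from the trunk to the crown leaves its own count unchanged, while the crown gains
`φ`. -/
theorem searchMeasure_boxTPrime_lt {F : Finset (Formula Pr)} {S : Multiset (Formula Pr)}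
    {φ : Formula Pr} (hF : φ ∈ F) :
    searchMeasure F ⟨none, {S, {φ}}, 0⟩ < searchMeasure F ⟨some S, 0, 0⟩ := by
  have hle := missing_le_card F (· ∈ ({φ} : Multiset (Formula Pr)))
  have hlt := missing_lt (F := F) (P := fun ψ => ∃ T ∈ (0 : Multiset (Multiset (Formula Pr))), ψ ∈ T)
    (Q := fun ψ => ∃ T ∈ ({S, {φ}} : Multiset (Multiset (Formula Pr))), ψ ∈ T)
    (by simp) hF (by simp) (by simp)
  refine searchMeasure_lt_of_crownMissing_lt ?_ ?_
  · simp only [crownMissing] at hlt ⊢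
    omega
  · simp only [componentMissing, Multiset.insert_eq_cons, Multiset.map_cons, Multiset.sum_cons,
      Multiset.map_singleton, Multiset.sum_singleton, Multiset.map_zero, Multiset.sum_zero,
      Option.elim]
    omega

/-- The formulas next to the hole. -/
def Context.content : Context Pr → Multiset (Formula Pr)
  | .trunk G => G.trunk.getD 0
  | .crown _ _ S => S

theorem searchMeasure_fill_lt {F : Finset (Formula Pr)} (K : Context Pr)
    {S T : Multiset (Formula Pr)} {φ : Formula Pr} (hF : φ ∈ F) (hT : φ ∈ T)
    (hS : φ ∉ K.content + S) :
    searchMeasure F (K.fill (S + T)) < searchMeasure F (K.fill S) := by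
  have hlt := missing_lt (F := F) (P := (· ∈ K.content + S)) (Q := (· ∈ K.content + (S + T)))
    (fun ψ => by simp only [Multiset.mem_add]; tauto) hF (by simp [hT]) hS
  refine searchMeasure_lt_of_componentMissing_lt ?_ ?_
  · rcases K with G | ⟨G, b, U⟩
    -- `crownMissing` ignores the trunk.
    · exact le_rfl
    · have hle (C : Multiset (Multiset (Formula Pr))) :
          missing F (fun ψ => ∃ V ∈ (U + (S + T)) ::ₘ C, ψ ∈ V) ≤
            missing F (fun ψ => ∃ V ∈ (U + S) ::ₘ C, ψ ∈ V) := by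
        refine missing_anti F fun ψ => ?_
        simp only [Multiset.mem_cons, exists_eq_or_imp, Multiset.mem_add]
        tauto
      cases b
      · exact Nat.add_le_add_right (hle _) _
      · exact Nat.add_le_add_left (hle _) _
  · rcases K with G | ⟨G, b, U⟩
    · simp only [Context.fill, Context.content, Sequent.addTrunk, componentMissing,
        Option.elim] at hlt ⊢
      omega
    · cases b <;> simp only [Context.fill, Context.content, Sequent.addComp, componentMissing,
        Multiset.map_cons, Multiset.sum_cons] at hlt ⊢ <;> omega

end Measure

/-! ### Exhibiting a sequent as the conclusion of a rule. -/

section Decomposition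

variable {Pr : Type v} {L : Logic} {G : Sequent Pr}

theorem Sequent.bounded_addComp {F : Finset (Formula Pr)} {b : Bracket}
    {S : Multiset (Formula Pr)} :
    (G.addComp b S).Bounded F ↔ G.Bounded F ∧ ∀ φ ∈ S, φ ∈ F := by
  have h (T) : (G.addComp b S).IsComponent T ↔ T = S ∨ G.IsComponent T := by
    cases b <;> simp only [IsComponent, addComp, Multiset.mem_add, Multiset.mem_cons] <;> tauto
  simp only [Bounded, h, forall_eq_or_imp]
  tauto

theorem Sequent.Bounded.fill {F : Finset (Formula Pr)} {K : Context Pr}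
    {S T : Multiset (Formula Pr)} (h : (K.fill S).Bounded F) (hT : ∀ φ ∈ T, φ ∈ F) :
    (K.fill (S + T)).Bounded F := by
  rcases K with G | ⟨G, b, U⟩
  · simp only [Bounded, IsComponent, Context.fill, addTrunk, or_imp, forall_and,
      Option.some.injEq, forall_eq', Multiset.mem_add] at h ⊢
    exact ⟨⟨h.1.1, h.1.2, hT⟩, h.2⟩
  · simp only [Context.fill, bounded_addComp, Multiset.mem_add, or_imp, forall_and] at h ⊢
    exact ⟨h.1, h.2.1, h.2.2, hT⟩

theorem Context.isLSequent_fill {K : Context Pr} {S : Multiset (Formula Pr)}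
    (T : Multiset (Formula Pr)) (h : (K.fill S).IsLSequent L) : (K.fill T).IsLSequent L := by
  rcases K with G | ⟨G, b, U⟩
  · cases L <;> simp_all [Context.fill, Sequent.IsLSequent, Sequent.IsLayered, Sequent.Shape,
      Sequent.addTrunk]
  · cases b <;> cases L <;>
      simp_all [Context.fill, Sequent.IsLSequent, Sequent.IsLayered, Sequent.Shape,
        Sequent.addComp]

theorem Sequent.IsComponent.exists_fill {S D : Multiset (Formula Pr)} (hS : G.IsComponent S)
    (hD : D ≤ S) : ∃ K : Context Pr, G = K.fill D ∧ K.content + D = S := by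
  obtain ⟨S, rfl⟩ := Multiset.le_iff_exists_add.1 hD
  rcases hS with hS | hS
  · refine ⟨.trunk ⟨some S, G.single, G.double⟩, ?_, add_comm _ _⟩
    ext1 <;> simp [Context.fill, Sequent.addTrunk, hS, add_comm]
  rcases Multiset.mem_add.1 hS with hS | hS
  · obtain ⟨C, hC⟩ := Multiset.exists_cons_of_mem hS
    refine ⟨.crown ⟨G.trunk, C, G.double⟩ .single S, ?_, add_comm _ _⟩
    ext1 <;> simp [Context.fill, Sequent.addComp, hC, add_comm]
  · obtain ⟨C, hC⟩ := Multiset.exists_cons_of_mem hS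
    refine ⟨.crown ⟨G.trunk, G.single, C⟩ .double S, ?_, add_comm _ _⟩
    ext1 <;> simp [Context.fill, Sequent.addComp, hC, add_comm]

/-- The last clause lets a second component be split off afterwards, as `diaC` requires. -/
theorem Sequent.exists_addComp {S : Multiset (Formula Pr)} (hS : S ∈ G.single + G.double) :
    ∃ b H, G = addComp H b S ∧
      ∀ T ∈ G.single + G.double, T ≠ S → T ∈ H.single + H.double := by
  rcases Multiset.mem_add.1 hS with hS | hS
  · obtain ⟨C, hC⟩ := Multiset.exists_cons_of_mem hS
    refine ⟨.single, ⟨G.trunk, C, G.double⟩, by ext1 <;> simp [addComp, hC], fun T hT hTS => ?_⟩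
    simpa [hC, hTS] using hT
  · obtain ⟨C, hC⟩ := Multiset.exists_cons_of_mem hS
    refine ⟨.double, ⟨G.trunk, G.single, C⟩, by ext1 <;> simp [addComp, hC], fun T hT hTS => ?_⟩
    simpa [hC, hTS] using hT

theorem Sequent.exists_addTrunk {S : Multiset (Formula Pr)} {φ : Formula Pr}
    (hS : G.trunk = some S) (hφ : φ ∈ S) :
    ∃ H, G = addTrunk H {φ} ∧ H.single = G.single ∧ H.double = G.double := by
  obtain ⟨S, rfl⟩ := Multiset.exists_cons_of_mem hφ
  refine ⟨⟨some S, G.single, G.double⟩, ?_, rfl, rfl⟩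
  ext1 <;> simp [addTrunk, hS, ← Multiset.singleton_add, add_comm]

theorem Context.refutes_of_fill_add {W : Type} {M : KripkeModel Pr W} {ρ : W} {D : W → Prop}
    {K : Context Pr} {S T : Multiset (Formula Pr)} (h : Refutes M ρ D (K.fill (S + T))) :
    Refutes M ρ D (K.fill S) := by
  obtain ⟨P, Q, hK⟩ := K.exists_refutes_fill_iff M ρ D
  rw [hK] at h ⊢
  obtain ⟨hP, w, hw, hS⟩ := h
  exact ⟨hP, w, hw, ((M.falsifies_add w S T).1 hS).1⟩

end Decomposition

/-! ### Completeness: a minimal counterexample is saturated. -/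

section Completeness

variable {Pr : Type v} {L : Logic} {F : Finset (Formula Pr)} {G : Sequent Pr}

/-- `G` is an underivable `L`-sequent without countermodel, minimal for the search measure. -/
structure Stuck (L : Logic) (F : Finset (Formula Pr)) (G : Sequent Pr) : Prop where
  closed : SubformulaClosed F
  isLSequent : G.IsLSequent L
  bounded : G.Bounded F
  not_derivable : ¬ Derivable L G
  not_hasCountermodel : ¬ HasCountermodel L G
  minimal : ∀ H : Sequent Pr, searchMeasure F H < searchMeasure F G → H.IsLSequent L →
    H.Bounded F → Derivable L H ∨ HasCountermodel L H

namespace Stuck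

theorem false_of_rule (h : Stuck L F G) {r : RuleName} {ps : List (Sequent Pr)} (hr : r ∈ rules L)
    (hrule : Rule r ps G) (hps : ∀ p ∈ ps, p.IsLSequent L ∧ Derivable L p) : False :=
  h.not_derivable (.step hr hrule (fun p hp => (hps p hp).1) h.isLSequent
    fun p hp => (hps p hp).2)

/-- The missing formula `φ` makes the premise smaller, so minimality applies; a countermodel of the
premise would refute `G`, which is contained in it. -/
theorem derivable_fill (h : Stuck L F G) {K : Context Pr} {S T : Multiset (Formula Pr)}
    (hG : G = K.fill S) (hT : ∀ φ ∈ T, φ ∈ F) {φ : Formula Pr} (hφ : φ ∈ T)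
    (hφ' : φ ∉ K.content + S) :
    (K.fill (S + T)).IsLSequent L ∧ Derivable L (K.fill (S + T)) := by
  subst hG
  have hL := K.isLSequent_fill (S + T) h.isLSequent
  refine ⟨hL, (h.minimal _ (searchMeasure_fill_lt K (hT φ hφ) hφ hφ') hL
    (h.bounded.fill hT)).resolve_right fun hc => h.not_hasCountermodel ?_⟩
  exact hc.mono fun _ _ _ _ => Context.refutes_of_fill_add

theorem derivable_addComp (h : Stuck L F G) {b : Bracket} {φ : Formula Pr} (hF : φ ∈ F)
    (hφ : ∀ S ∈ G.comps b, φ ∉ S) (hL : (G.addComp b {φ}).IsLSequent L) :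
    (G.addComp b {φ}).IsLSequent L ∧ Derivable L (G.addComp b {φ}) := by
  refine ⟨hL, (h.minimal _ (searchMeasure_addComp_lt hF hφ) hL
    (Sequent.bounded_addComp.2 ⟨h.bounded, by simpa using hF⟩)).resolve_right fun hc =>
      h.not_hasCountermodel ?_⟩
  exact hc.mono fun _ _ _ _ hR => ((refutes_addComp _ _ _).1 hR).1

theorem top_notMem (h : Stuck L F G) {S : Multiset (Formula Pr)} (hS : G.IsComponent S) :
    .top ∉ S := by
  intro ht
  obtain ⟨K, rfl, -⟩ := hS.exists_fill (Multiset.singleton_le.2 ht)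
  exact h.false_of_rule (by cases L <;> simp [rules, commonRules]) (.idTop K) (by simp)

theorem natom_notMem (h : Stuck L F G) {S : Multiset (Formula Pr)} (hS : G.IsComponent S) {p : Pr}
    (hp : .atom p ∈ S) : .natom p ∉ S := by
  intro hn
  have hle : ({.atom p, .natom p} : Multiset (Formula Pr)) ≤ S := by
    rw [Multiset.le_iff_subset (by simp)]
    intro φ
    simp only [Multiset.insert_eq_cons, Multiset.mem_cons, Multiset.mem_singleton]
    rintro (rfl | rfl) <;> assumption
  obtain ⟨K, rfl, -⟩ := hS.exists_fill hle
  exact h.false_of_rule (by cases L <;> simp [rules, commonRules]) (.idP K p) (by simp)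

theorem and_mem (h : Stuck L F G) {S : Multiset (Formula Pr)} (hS : G.IsComponent S)
    {φ ψ : Formula Pr} (hand : .and φ ψ ∈ S) : φ ∈ S ∨ ψ ∈ S := by
  by_contra! hn
  obtain ⟨hφ, hψ⟩ := hn
  have hF := h.closed.and _ _ (h.bounded _ hS _ hand)
  obtain ⟨K, hG, rfl⟩ := hS.exists_fill (Multiset.singleton_le.2 hand)
  refine h.false_of_rule (r := .and) (by cases L <;> simp [rules, commonRules])
    (hG ▸ Rule.and K φ ψ) ?_
  simp only [List.mem_cons, List.not_mem_nil, or_false, forall_eq_or_imp, forall_eq]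
  exact ⟨h.derivable_fill (T := {φ}) hG (by simpa using hF.1) (by simp) hφ,
    h.derivable_fill (T := {ψ}) hG (by simpa using hF.2) (by simp) hψ⟩

theorem or_mem (h : Stuck L F G) {S : Multiset (Formula Pr)} (hS : G.IsComponent S)
    {φ ψ : Formula Pr} (hor : .or φ ψ ∈ S) : φ ∈ S ∧ ψ ∈ S := by
  by_contra hn
  have hF := h.closed.or _ _ (h.bounded _ hS _ hor)
  -- Both disjuncts are added at once; one that is absent is enough for the measure to drop.
  have hn : ∃ χ ∈ ({φ, ψ} : Multiset (Formula Pr)), χ ∉ S := by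
    by_contra! hall
    exact hn ⟨hall φ (by simp), hall ψ (by simp)⟩
  obtain ⟨χ, hχ, hχS⟩ := hn
  obtain ⟨K, hG, rfl⟩ := hS.exists_fill (Multiset.singleton_le.2 hor)
  refine h.false_of_rule (r := .or) (by cases L <;> simp [rules, commonRules])
    (hG ▸ Rule.or K φ ψ) ?_
  simp only [List.mem_singleton, forall_eq]
  exact h.derivable_fill (T := {φ, ψ}) hG (by simpa using hF) hχ hχS

theorem dia_mem_crown (h : Stuck L F G) {S T : Multiset (Formula Pr)}
    (hS : S ∈ G.single + G.double) (hT : T ∈ G.single + G.double) {φ : Formula Pr}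
    (hdia : .dia φ ∈ S) : φ ∈ T := by
  by_contra hφ
  have hF := h.closed.dia _ (h.bounded _ (Or.inr hS) _ hdia)
  obtain ⟨b, H, hG, hH⟩ := Sequent.exists_addComp hS
  obtain ⟨S, rfl⟩ := Multiset.exists_cons_of_mem hdia
  rw [← Multiset.singleton_add, add_comm] at hG
  -- Components with equal contents need not be told apart: rule `t` then adds `φ` to `S` itself.
  by_cases hTS : T = .dia φ ::ₘ S
  · subst hTS
    refine h.false_of_rule (r := .t) (by cases L <;> simp [rules, commonRules])
      (hG ▸ Rule.t H b S φ) ?_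
    simp only [List.mem_singleton, forall_eq]
    exact h.derivable_fill (K := .crown H b S) (S := {Formula.dia φ}) (T := {φ}) (φ := φ)
      hG (by simpa using hF) (by simp) (by
        rwa [Context.content, add_comm, Multiset.singleton_add])
  · obtain ⟨c, H', rfl, -⟩ := Sequent.exists_addComp (hH T hT hTS)
    have hG' : G = (H'.addComp b (S + {.dia φ})).addComp c T := by
      rw [hG]
      cases b <;> cases c <;> simp [Sequent.addComp, Multiset.cons_swap]
    refine h.false_of_rule (r := .diaC) (by cases L <;> simp [rules, commonRules])
      (hG' ▸ Rule.diaC H' b c S T φ) ?_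
    simp only [List.mem_singleton, forall_eq]
    have := h.derivable_fill (K := .crown (H'.addComp b (S + {.dia φ})) c T) (S := 0) (T := {φ})
      (φ := φ) (by simpa [Context.fill] using hG') (by simpa using hF) (by simp)
      (by simpa [Context.content] using hφ)
    simpa only [zero_add, Context.fill] using this

theorem dia_mem_trunk (h : Stuck L F G) {S T : Multiset (Formula Pr)}
    (hS : G.trunk = some S) (hT : T ∈ G.single) {φ : Formula Pr}
    (hdia : .dia φ ∈ S) : φ ∈ T := by
  by_contra hφ
  have hF := h.closed.dia _ (h.bounded _ (Or.inl hS) _ hdia)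
  obtain ⟨H, hG, hs, hd⟩ := Sequent.exists_addTrunk hS hdia
  obtain ⟨C, hC⟩ := Multiset.exists_cons_of_mem hT
  have hG' : G = ((⟨H.trunk, C, H.double⟩ : Sequent Pr).addTrunk {.dia φ}).addComp .single T := by
    rw [hG]
    simp [Sequent.addTrunk, Sequent.addComp, hs, hC]
  -- A trunk together with a `[ ]`-component excludes KB5 and S5.
  have hr : RuleName.diaT ∈ rules L := by
    obtain ⟨-, hL⟩ := h.isLSequent
    cases L <;> simp [rules, commonRules, Sequent.Shape, hS, hC] at hL ⊢
  refine h.false_of_rule hr (hG' ▸ Rule.diaT _ T φ) ?_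
  simp only [List.mem_singleton, forall_eq]
  have := h.derivable_fill (K := .crown (Sequent.addTrunk ⟨H.trunk, C, H.double⟩ {.dia φ})
    .single T) (S := 0) (T := {φ}) (φ := φ) (by simpa [Context.fill] using hG') (by simpa using hF)
    (by simp) (by simpa [Context.content] using hφ)
  simpa only [zero_add, Context.fill] using this

theorem box_mem_trunk (h : Stuck L F G) {S : Multiset (Formula Pr)}
    (hS : G.trunk = some S) {φ : Formula Pr} (hbox : .box φ ∈ S) : ∃ T ∈ G.single, φ ∈ T := by
  by_contra! hφ
  have hF := h.closed.box _ (h.bounded _ (Or.inl hS) _ hbox)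
  have hL := h.isLSequent
  by_cases hr : RuleName.boxT ∈ rules L
  · obtain ⟨H, hG, -⟩ := Sequent.exists_addTrunk hS hbox
    refine h.false_of_rule hr (hG ▸ Rule.boxT H φ) ?_
    simp only [List.mem_singleton, forall_eq]
    refine h.derivable_addComp hF hφ ?_
    cases L <;> simp_all [rules, commonRules, Sequent.IsLSequent, Sequent.IsLayered,
      Sequent.Shape, Sequent.addComp]
  · have hL' : L = .KB5 ∧ G.single = 0 ∧ G.double = 0 := by
      cases L <;> simp_all [rules, commonRules, Sequent.IsLSequent, Sequent.Shape]
    obtain ⟨rfl, hs, hd⟩ := hL'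
    obtain ⟨S', hS'⟩ := Multiset.exists_cons_of_mem hbox
    rw [← Multiset.singleton_add, add_comm] at hS'
    have hG : G = ⟨some S, 0, 0⟩ := by ext1 <;> assumption
    have hlseq : (⟨none, {S, {φ}}, 0⟩ : Sequent Pr).IsLSequent .KB5 := by
      simp [Sequent.IsLSequent, Sequent.IsLayered, Sequent.Shape]
    refine h.false_of_rule (r := .boxTPrime) (by simp [rules])
      (hG ▸ hS' ▸ Rule.boxTPrime S' φ) ?_
    simp only [List.mem_singleton, forall_eq]
    refine ⟨hlseq, (h.minimal _ (hG ▸ searchMeasure_boxTPrime_lt hF) hlseq ?_).resolve_right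
      fun hc => h.not_hasCountermodel ?_⟩
    · have := h.bounded S (Or.inl hS)
      simpa [Sequent.Bounded, Sequent.IsComponent, hF] using this
    -- The premise has no trunk, so its countermodel refutes `S` at a successor `w` of the root.
    -- That edge forces a cluster frame, where `w` may serve as root and refute the trunk `S`.
    · obtain ⟨W, M, ρ, ⟨hE, hFS⟩, -, hR, -⟩ := hc
      obtain ⟨w, hw, hwS⟩ := hR S (by simp)
      refine ⟨W, M, w, ⟨hE, Or.inr ?_⟩, ?_⟩
      · rcases hFS with ⟨h1, hn⟩ | h
        · exact absurd (h1 w ▸ hw) hn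
        · exact h
      · rw [hG]
        exact ⟨by simpa using hwS, by simp, by simp⟩

/-- If `φ` is in no crown component, it is new for either bracket, so whichever of `boxC` and
`boxCPrime` the logic has can be applied backwards. -/
theorem box_mem_crown (h : Stuck L F G) {S : Multiset (Formula Pr)}
    (hS : S ∈ G.single + G.double) {φ : Formula Pr} (hbox : .box φ ∈ S) :
    ∃ T ∈ G.single + G.double, φ ∈ T := by
  by_contra! hφ
  have hF := h.closed.box _ (h.bounded _ (Or.inr hS) _ hbox)
  obtain ⟨hlay, hshape⟩ := h.isLSequent
  have hs : 1 ≤ G.single.card := by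
    rcases Multiset.mem_add.1 hS with hS | hS
    · exact Multiset.card_pos_iff_exists_mem.2 ⟨S, hS⟩
    · exact hlay (Multiset.card_pos_iff_exists_mem.2 ⟨S, hS⟩)
  obtain ⟨b, H, hG, -⟩ := Sequent.exists_addComp hS
  obtain ⟨S, rfl⟩ := Multiset.exists_cons_of_mem hbox
  rw [← Multiset.singleton_add, add_comm] at hG
  by_cases hr : RuleName.boxC ∈ rules L
  · refine h.false_of_rule hr (hG ▸ Rule.boxC H b S φ) ?_
    simp only [List.mem_singleton, forall_eq]
    refine h.derivable_addComp hF (fun T hT => hφ T (Multiset.mem_add.2 (Or.inl hT))) ⟨?_, ?_⟩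
    · simp [Sequent.IsLayered, Sequent.addComp]
    · cases L <;> simp only [Sequent.Shape, Sequent.addComp, Multiset.card_cons] at hshape ⊢
      case KB5 =>
        rcases hshape with hshape | hshape
        · exact Or.inl ⟨hshape.1, by omega, hshape.2.2⟩
        · simp [hshape.2.1] at hs
      case S5 => exact ⟨hshape.1, by omega, hshape.2.2⟩
      all_goals exact hshape
  · have hr' : RuleName.boxCPrime ∈ rules L := by
      cases L <;> simp [rules, commonRules] at hr ⊢
    refine h.false_of_rule hr' (hG ▸ Rule.boxCPrime H b S φ) ?_
    simp only [List.mem_singleton, forall_eq]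
    refine h.derivable_addComp hF (fun T hT => hφ T (Multiset.mem_add.2 (Or.inr hT)))
      ⟨fun _ => hs, ?_⟩
    cases L <;> first | (simp [rules, commonRules] at hr'; done) | exact hshape

theorem saturated (h : Stuck L F G) : Saturated G where
  top _ hS := h.top_notMem hS
  atom _ hS _ hp := h.natom_notMem hS hp
  and _ hS _ _ hφ := h.and_mem hS hφ
  or _ hS _ _ hφ := h.or_mem hS hφ
  boxTrunk _ hS _ hφ := h.box_mem_trunk hS hφ
  diaTrunk _ hS _ hφ _ hT := h.dia_mem_trunk hS hT hφ
  boxCrown _ hS _ hφ := h.box_mem_crown hS hφ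
  diaCrown _ hS _ hφ _ hT := h.dia_mem_crown hS hT hφ

/-- With no `[ ]`-component, `[φ]` is new, so `dT` gives a smaller premise. -/
theorem dia_notMem (h : Stuck L F G) (hr : RuleName.dT ∈ rules L) (hs : G.single = 0)
    {S : Multiset (Formula Pr)} (hS : G.trunk = some S) (φ : Formula Pr) : .dia φ ∉ S := by
  intro hdia
  have hF := h.closed.dia _ (h.bounded _ (Or.inl hS) _ hdia)
  obtain ⟨H, hG, -⟩ := Sequent.exists_addTrunk hS hdia
  refine h.false_of_rule hr (hG ▸ Rule.dT H φ) ?_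
  simp only [List.mem_singleton, forall_eq]
  refine h.derivable_addComp hF (by simp [Sequent.comps, hs]) ?_
  obtain ⟨-, hL⟩ := h.isLSequent
  cases L <;> first | (simp [rules, commonRules] at hr; done) |
    exact ⟨by simp [Sequent.IsLayered, Sequent.addComp], hL⟩

/-- The label model works unless the logic is serial and the crown is empty. In that case saturation
leaves no box in the trunk and `dT` leaves no diamond, so an empty `[ ]`-component can be added
without losing saturation, giving the root a successor. -/
theorem false (h : Stuck L F G) : False := by
  by_cases hser : RuleName.dT ∈ rules L → G.single ≠ 0
  · exact h.not_hasCountermodel (h.saturated.hasCountermodel h.isLSequent hser)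
  push Not at hser
  obtain ⟨hr, hs⟩ := hser
  obtain ⟨hlay, hL⟩ := h.isLSequent
  have hd : G.double = 0 := by
    by_contra hd
    have := hlay (Multiset.card_pos.2 hd)
    simp [hs] at this
  have hsat := h.saturated
  have hbox : ∀ S, G.trunk = some S → ∀ φ, .box φ ∉ S := fun S hS φ hφ => by
    simpa [hs] using hsat.boxTrunk S hS φ hφ
  have hcomp (S) (hS : (G.addComp .single 0).IsComponent S) : G.IsComponent S ∨ S = 0 := by
    simpa [Sequent.IsComponent, Sequent.addComp, hs, hd] using hS
  have hcrown (S) (hS : S ∈ (G.addComp .single 0).single + (G.addComp .single 0).double) :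
      S = 0 := by
    simpa [Sequent.addComp, hs, hd] using hS
  have hsat' : Saturated (G.addComp .single 0) :=
    { top := fun S hS => by
        rcases hcomp S hS with hS | rfl
        · exact hsat.top S hS
        · simp
      atom := fun S hS => by
        rcases hcomp S hS with hS | rfl
        · exact hsat.atom S hS
        · simp
      and := fun S hS => by
        rcases hcomp S hS with hS | rfl
        · exact hsat.and S hS
        · simp
      or := fun S hS => by
        rcases hcomp S hS with hS | rfl
        · exact hsat.or S hS
        · simp
      boxTrunk := fun S hS φ hφ => absurd hφ (hbox S hS φ)
      diaTrunk := fun S hS φ hφ => absurd hφ (h.dia_notMem hr hs hS φ)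
      boxCrown := fun S hS φ hφ => by
        obtain rfl := hcrown S hS
        simp at hφ
      diaCrown := fun S hS φ hφ => by
        obtain rfl := hcrown S hS
        simp at hφ }
  -- A countermodel of the enlarged sequent also refutes `G`.
  refine h.not_hasCountermodel ((hsat'.hasCountermodel (L := L) ⟨?_, ?_⟩ ?_).mono
    fun _ _ _ _ hR => ((refutes_addComp _ _ _).1 hR).1)
  · simp [Sequent.IsLayered, Sequent.addComp]
  · cases L <;> first | (simp [rules, commonRules] at hr; done) | exact hL
  · simp [Sequent.addComp]

end Stuck

theorem derivable_or_hasCountermodel (hF : SubformulaClosed F) (hG : G.IsLSequent L)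
    (hB : G.Bounded F) : Derivable L G ∨ HasCountermodel L G := by
  induction hn : searchMeasure F G using Nat.strong_induction_on generalizing G with
  | _ n ih =>
    by_contra! hcon
    subst hn
    exact Stuck.false ⟨hF, hG, hB, hcon.1, hcon.2, fun H hlt hL hB => ih _ hlt hL hB rfl⟩

theorem ValidSequent.derivable (hG : G.IsLSequent L) (h : ValidSequent L G) : Derivable L G := by
  obtain ⟨F, hF, hB⟩ := exists_bounded G
  exact (derivable_or_hasCountermodel hF hG hB).resolve_right fun hc => hc.not_validSequent h

end Completeness

end Layered

theorem mainTheorem2 {Pr : Type*} [Countable Pr] (L : Layered.Logic) (G : Layered.Sequent Pr)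
    (hG : G.IsLSequent L) :
    (Layered.Derivable L G ↔ Layered.ValidFormula L G.iota) ∧
      (Layered.ValidFormula L G.iota ↔ Layered.ValidSequent L G) :=
  ⟨⟨fun h => h.validFormula, fun h => (h.validSequent hG).derivable hG⟩,
    fun h => h.validSequent hG, fun h => (h.derivable hG).validFormula⟩
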